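/- Let $d, f_c \in \mathbb{N}$, let $\mathbb{T}^d = (\mathbb{R}/\mathbb{Z})^d$, and for $\ell \in \mathbb{N}$ let $\Omega_\ell = \{-\ell,\dots,\ell\}^d$ and $m_\ell = (2\ell+1)^d$. Vectors of $\mathbb{C}^{m_\ell}$ and matrices of $\mathbb{C}^{m_\ell\times m_\ell}$ are indexed by $\Omega_\ell$. Let $z = (z_k)_{k\in\Omega_{f_c}} \in \mathbb{C}^{(2f_c+1)^d}$. Consider the problem $$(\mathcal{Q}_0(z))\qquad \min_{\mu} |\mu|(\mathbb{T}^d) \quad\text{s.t.}\quad \int_{\mathbb{T}^d} e^{-2\imath\pi\langle k,x\rangle}\,d\mu(x) = z_k \quad \forall k\in\Omega_{f_c},$$ where $\mu$ ranges over the complex Borel measures on $\mathbb{T}^d$ and $|\mu|$ is the total variation of $\mu$. For $\ell \ge f_c$ consider the semidefinite program $$(\mathcal{Q}_0^{(\ell)}(z))\qquad \min_{R,\tilde z,\tau} \frac12\left(\frac{1}{m_\ell}\operatorname{Tr}(R)+\tau\right),$$ where $R\in\mathbb{C}^{m_\ell\times m_\ell}$ is Hermitian positive semidefinite, $\tilde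 z\in\mathbb{C}^{m_\ell}$ and $\tau\in\mathbb{R}$, subject to (a) $\begin{bmatrix} R & \tilde z\\ \tilde z^* & \tau\end{bmatrix}\succeq 0$; (b) $\tilde z_k = z_k$ for all $k\in\Omega_{f_c}$; (c) $R$ is a generalized Toeplitz matrix, i.e. $R_{i+k,j+k}=R_{i,j}$ for all $i,j,k\in\Omega_\ell$ with $i+k,\,j+k\in\Omega_\ell$. Then $\mathcal{Q}_0(z)$ and, for every $\ell\ge f_c$, $\mathcal{Q}_0^{(\ell)}(z)$ attain their minima; for every $\ell\ge f_c$, $$\min \mathcal{Q}_0^{(\ell)}(z) \le \min \mathcal{Q}_0^{(\ell+1)}(z)\le \min \mathcal{Q}_0(z);$$ and $$\lim_{\ell\to+\infty} \min \mathcal{Q}_0^{(\ell)}(z) = \min \mathcal{Q}_0(z).$$ -/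

import Mathlib

open MeasureTheory Filter Topology
open scoped ComplexOrder

noncomputable section

namespace SuperRes

/-- The set of multi-indices `k ∈ ℤ^d` with `|k|_∞ ≤ ℓ`. -/
abbrev box (d ℓ : ℕ) : Finset (Fin d → ℤ) :=
  Finset.Icc (fun _ => -(ℓ : ℤ)) (fun _ => (ℓ : ℤ))

/-- The index type of `ℂ^{(2ℓ+1)^d}`. -/
abbrev Idx (d ℓ : ℕ) : Type := ↥(box d ℓ)

/-- There are `(2ℓ+1)^d` multi-indices in the box. -/
theorem card_idx (d ℓ : ℕ) : Fintype.card (Idx d ℓ) = (2 * ℓ + 1) ^ d := by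
  have h : ((ℓ : ℤ) + 1 + (ℓ : ℤ)).toNat = 2 * ℓ + 1 := by omega
  simp [box, Pi.card_Icc, h]

/-- The Fourier coefficient `∫ e^{-2πi⟨k,x⟩} dμ(x)` of a complex Borel measure `μ` on the torus
`(ℝ/ℤ)^d`. -/
def measFourierCoeff {d : ℕ} (μ : ComplexMeasure (UnitAddTorus (Fin d))) (k : Fin d → ℤ) : ℂ :=
  μ.integral (fun x => UnitAddTorus.mFourier (-k) x) (ContinuousLinearMap.mul ℝ ℂ)

/-- The total variation norm `|μ|(𝕋^d)`. -/
def tvNorm {d : ℕ} (μ : ComplexMeasure (UnitAddTorus (Fin d))) : ℝ :=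
  μ.variation.real Set.univ

/-- Objective values of the feasible points of the total variation minimization problem. -/
def tvValues {d fc : ℕ} (z : Idx d fc → ℂ) : Set ℝ :=
  {v | ∃ μ : ComplexMeasure (UnitAddTorus (Fin d)),
    (∀ k : Idx d fc, measFourierCoeff μ k = z k) ∧ v = tvNorm μ}

/-- The value of the total variation minimization problem. -/
def tvMin {d fc : ℕ} (z : Idx d fc → ℂ) : ℝ := sInf (tvValues z)

/-- Generalized (multilevel) Toeplitz matrices. -/
def IsToeplitz {d ℓ : ℕ} (R : Matrix (Idx d ℓ) (Idx d ℓ) ℂ) : Prop :=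
  ∀ i j k : Idx d ℓ, ∀ (hi : i.1 + k.1 ∈ box d ℓ) (hj : j.1 + k.1 ∈ box d ℓ),
    R ⟨i.1 + k.1, hi⟩ ⟨j.1 + k.1, hj⟩ = R i j

/-- The Hermitian block matrix `[[R, w], [w*, τ]]`. -/
def blockMatrix {d ℓ : ℕ} (R : Matrix (Idx d ℓ) (Idx d ℓ) ℂ) (w : Idx d ℓ → ℂ) (τ : ℝ) :
    Matrix (Idx d ℓ ⊕ Unit) (Idx d ℓ ⊕ Unit) ℂ :=
  Matrix.fromBlocks R (Matrix.of fun i _ => w i) (Matrix.of fun _ j => star (w j))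
    (Matrix.of fun _ _ => (τ : ℂ))

/-- Feasible points of the semidefinite relaxation of order `ℓ` (used for `ℓ ≥ fc`). -/
structure SdpFeasible {d fc : ℕ} (z : Idx d fc → ℂ) (ℓ : ℕ)
    (R : Matrix (Idx d ℓ) (Idx d ℓ) ℂ) (w : Idx d ℓ → ℂ) (τ : ℝ) : Prop where
  posSemidef : R.PosSemidef
  block_posSemidef : (blockMatrix R w τ).PosSemidef
  interp : ∀ (k : Fin d → ℤ) (hc : k ∈ box d fc) (hℓ : k ∈ box d ℓ), w ⟨k, hℓ⟩ = z ⟨k, hc⟩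
  toeplitz : IsToeplitz R

/-- Objective values of the feasible points of the semidefinite relaxation of order `ℓ`. The
trace is real since `R` is Hermitian. -/
def sdpValues {d fc : ℕ} (z : Idx d fc → ℂ) (ℓ : ℕ) : Set ℝ :=
  {v | ∃ (R : Matrix (Idx d ℓ) (Idx d ℓ) ℂ) (w : Idx d ℓ → ℂ) (τ : ℝ),
    SdpFeasible z ℓ R w τ ∧ v = 1 / 2 * (1 / (2 * (ℓ : ℝ) + 1) ^ d * R.trace.re + τ)}

/-- The value of the semidefinite relaxation of order `ℓ`. -/
def sdpMin {d fc : ℕ} (z : Idx d fc → ℂ) (ℓ : ℕ) : ℝ := sInf (sdpValues z ℓ)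

end SuperRes

end

/-! Both problems are compared with the norm of the functional sending `p = ∑ c_k e_{-k}` to `∑ c_k
z_k` on trigonometric polynomials with the supremum norm; `DualBound z N` says that this norm is at
most `N`. The total variation of any measure interpolating `z` is a dual bound. Conversely,
Hahn-Banach separation turns any dual bound `N` into an interpolating sum of Dirac masses of total
weight `N` (`DualBound.isAtomic`). Hence `tvMin z` is the least dual bound, and it is attained.

The same atoms produce a feasible point of every relaxation with objective `N`
(`IsAtomic.mem_sdpValues`), so `sdpMin ≤ tvMin`. In the other direction, a feasible point of order
`ℓ` yields a dual bound, at the price of replacing the normalization `(2ℓ+1)^d` of the trace by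
`(2(ℓ-fc)+1)^d` (`SdpFeasible.dualBound`). The loss comes from averaging over those translates of
the small box that stay inside the large one. Therefore `((2(ℓ-fc)+1)/(2ℓ+1))^d * tvMin ≤ sdpMin`,
which gives convergence with an explicit rate and without extracting a limit measure. -/

noncomputable section

namespace SuperRes

/-! ### Complex measures -/

section ComplexMeasures

variable {X : Type*} [MeasurableSpace X]

/-- The total variation of a complex measure is finite. -/
instance isFiniteMeasure_variation (μ : ComplexMeasure X) : IsFiniteMeasure μ.variation := by
  have h : μ.variation ≤
      (ComplexMeasure.re μ).totalVariation + (ComplexMeasure.im μ).totalVariation := by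
    refine VectorMeasure.variation_le_of_forall_enorm_le fun s _ => ?_
    have h1 := SignedMeasure.enorm_le_totalVariation (ComplexMeasure.re μ) s
    have h2 := SignedMeasure.enorm_le_totalVariation (ComplexMeasure.im μ) s
    refine le_trans ?_ (add_le_add h1 h2)
    change ‖μ s‖ₑ ≤ ‖(μ s).re‖ₑ + ‖(μ s).im‖ₑ
    rw [← ofReal_norm, ← ofReal_norm, ← ofReal_norm,
      ← ENNReal.ofReal_add (norm_nonneg _) (norm_nonneg _)]
    exact ENNReal.ofReal_le_ofReal (Complex.norm_le_abs_re_add_abs_im _)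
  exact isFiniteMeasure_of_le _ h

/-- The pairing is bilinear over `ℝ` only; complex scalars come out because multiplication in `ℂ` is
associative. -/
theorem integral_const_mul_complexMeasure (μ : ComplexMeasure X) (c : ℂ) (f : X → ℂ) :
    μ.integral (fun x => c * f x) (ContinuousLinearMap.mul ℝ ℂ) =
      c * μ.integral f (ContinuousLinearMap.mul ℝ ℂ) := by
  have := setToFun_smul (𝕜 := ℂ)
    (dominatedFinMeasAdditive_cbmApplyMeasure μ (ContinuousLinearMap.mul ℝ ℂ))
    (fun c s x => by
      change (c • x) * μ s = c • (x * μ s)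
      rw [smul_mul_assoc]) c f
  exact this

end ComplexMeasures

variable {d : ℕ}

theorem integrable_mFourier (μ : ComplexMeasure (UnitAddTorus (Fin d))) (k : Fin d → ℤ) :
    μ.Integrable (fun x => UnitAddTorus.mFourier k x) := by
  refine Integrable.of_bound (C := 1) ?_ (Eventually.of_forall fun x => ?_)
  · exact (UnitAddTorus.mFourier k).continuous.aestronglyMeasurable
  · exact ((UnitAddTorus.mFourier k).norm_coe_le_norm x).trans_eq UnitAddTorus.mFourier_norm

/-- Pairing a measure with a trigonometric polynomial. -/
theorem norm_sum_mul_measFourierCoeff_le (μ : ComplexMeasure (UnitAddTorus (Fin d)))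
    {ι : Type*} (s : Finset ι) (k : ι → Fin d → ℤ) (c : ι → ℂ) {M : ℝ}
    (hM : ∀ x, ‖∑ i ∈ s, c i * UnitAddTorus.mFourier (-k i) x‖ ≤ M) :
    ‖∑ i ∈ s, c i * measFourierCoeff μ (k i)‖ ≤ tvNorm μ * M := by
  have h : ∑ i ∈ s, c i * measFourierCoeff μ (k i) =
      μ.integral (fun x => ∑ i ∈ s, c i * UnitAddTorus.mFourier (-k i) x)
        (ContinuousLinearMap.mul ℝ ℂ) := by
    rw [VectorMeasure.integral_finsetSum]
    · refine Finset.sum_congr rfl fun i _ => ?_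
      rw [integral_const_mul_complexMeasure]
      rfl
    · intro i _
      exact (integrable_mFourier μ (-k i)).const_mul (c i)
  rw [h]
  refine (VectorMeasure.norm_integral_le_of_norm_le_const (Eventually.of_forall hM)).trans ?_
  rw [ContinuousLinearMap.opNorm_mul, mul_one, mul_comm, tvNorm]

/-- A finite sum of Dirac masses with prescribed Fourier coefficients. -/
theorem exists_measure_of_atoms {n : ℕ} (a : Fin n → ℂ) (x : Fin n → UnitAddTorus (Fin d)) :
    ∃ μ : ComplexMeasure (UnitAddTorus (Fin d)),
      (∀ k, measFourierCoeff μ k = ∑ i, a i * UnitAddTorus.mFourier (-k) (x i)) ∧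
      tvNorm μ ≤ ∑ i, ‖a i‖ := by
  refine ⟨∑ i, VectorMeasure.dirac (x i) (a i), fun k => ?_, ?_⟩
  · rw [measFourierCoeff, VectorMeasure.integral_finsetSum_vectorMeasure]
    · refine Finset.sum_congr rfl fun i _ => ?_
      rw [VectorMeasure.integral_dirac]
      simp [mul_comm]
    · intro i _
      exact integrable_mFourier _ _
  · have h := VectorMeasure.variation_finsetSum_le Finset.univ
      (fun i => VectorMeasure.dirac (x i) (a i))
    have h2 := h Set.univ
    rw [tvNorm, Measure.real]
    refine ENNReal.toReal_le_of_le_ofReal (by positivity) (h2.trans ?_)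
    rw [ENNReal.ofReal_sum_of_nonneg (fun _ _ => norm_nonneg _)]
    simp [Measure.finsetSum_apply]

/-! ### Bessel's inequality for products of trigonometric polynomials -/

theorem norm_toLp_mul_le {X : Type*} [TopologicalSpace X] [CompactSpace X] [MeasurableSpace X]
    [BorelSpace X] [SecondCountableTopologyEither X ℂ] (ν : Measure X) [IsFiniteMeasure ν]
    (f g : C(X, ℂ)) {M : ℝ} (hM : ∀ x, ‖f x‖ ≤ M) :
    ‖ContinuousMap.toLp (E := ℂ) 2 ν ℂ (f * g)‖ ≤ M * ‖ContinuousMap.toLp (E := ℂ) 2 ν ℂ g‖ := by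
  refine Lp.norm_le_mul_norm_of_ae_le_mul ?_
  filter_upwards [ContinuousMap.coeFn_toLp (𝕜 := ℂ) (p := 2) ν (f * g),
    ContinuousMap.coeFn_toLp (𝕜 := ℂ) (p := 2) ν g] with x h1 h2
  rw [h1, h2, ContinuousMap.mul_apply, norm_mul]
  exact mul_le_mul_of_nonneg_right (hM x) (norm_nonneg _)

/-- With `p = ∑ u_k e_{-k}` and `q = ∑ b_a e_a`, the inner sum is the Fourier coefficient of `p * q`
at `s`; `hA` ensures that truncating `b` to `A` loses no term. Bessel bounds the left side by `‖p
q‖² ≤ M² ‖q‖²`, and Parseval evaluates `‖q‖²`. -/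
theorem sum_norm_sq_correlation_le_of_orthonormal {d : ℕ} {ν : Measure (UnitAddTorus (Fin d))}
    [IsFiniteMeasure ν]
    (ho : Orthonormal ℂ fun n : Fin d → ℤ =>
      ContinuousMap.toLp (E := ℂ) 2 ν ℂ (UnitAddTorus.mFourier n))
    {A S I : Finset (Fin d → ℤ)} (b u : (Fin d → ℤ) → ℂ) {M : ℝ}
    (hM : ∀ x, ‖∑ k ∈ I, u k * UnitAddTorus.mFourier (-k) x‖ ≤ M)
    (hA : ∀ s ∈ S, ∀ k ∈ I, k + s ∈ A) :
    ∑ s ∈ S, ‖∑ k ∈ I, u k * b (k + s)‖ ^ 2 ≤ M ^ 2 * ∑ a ∈ A, ‖b a‖ ^ 2 := by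
  set p : C(UnitAddTorus (Fin d), ℂ) := ∑ k ∈ I, u k • UnitAddTorus.mFourier (-k) with hp
  set q : C(UnitAddTorus (Fin d), ℂ) := ∑ a ∈ A, b a • UnitAddTorus.mFourier a with hq
  have hpM : ∀ x, ‖p x‖ ≤ M := fun x => by simpa [hp] using hM x
  have hbound := norm_toLp_mul_le ν p q hpM
  have hpq : p * q = ∑ k ∈ I, ∑ a ∈ A, (u k * b a) • UnitAddTorus.mFourier (a - k) := by
    rw [hp, hq, Finset.sum_mul_sum]
    refine Finset.sum_congr rfl fun k _ => Finset.sum_congr rfl fun a _ => ?_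
    ext x
    simp only [ContinuousMap.mul_apply, ContinuousMap.smul_apply, smul_eq_mul, sub_eq_add_neg,
      UnitAddTorus.mFourier_add]
    ring
  have hqn : ‖ContinuousMap.toLp (E := ℂ) 2 ν ℂ q‖ ^ 2 = ∑ a ∈ A, ‖b a‖ ^ 2 := by
    have h := ho.inner_sum b b A
    rw [← Complex.ofReal_inj, Complex.ofReal_pow]
    refine (inner_self_eq_norm_sq_to_K (𝕜 := ℂ)
      (ContinuousMap.toLp (E := ℂ) 2 ν ℂ q)).symm.trans ?_
    simp only [hq, map_sum, map_smul]
    refine h.trans ?_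
    simp [Complex.conj_mul']
  have hinner : ∀ s ∈ S, inner ℂ (ContinuousMap.toLp (E := ℂ) 2 ν ℂ (UnitAddTorus.mFourier s))
      (ContinuousMap.toLp (E := ℂ) 2 ν ℂ (p * q)) = ∑ k ∈ I, u k * b (k + s) := by
    intro s hs
    simp only [hpq, map_sum, map_smul, inner_sum, inner_smul_right]
    refine Finset.sum_congr rfl fun k hk => ?_
    rw [Finset.sum_eq_single_of_mem (k + s) (hA s hs k hk)]
    · rw [orthonormal_iff_ite.mp ho, if_pos (by abel), mul_one]
    · intro a _ hne
      rw [orthonormal_iff_ite.mp ho, if_neg, mul_zero]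
      rintro rfl
      exact hne (by abel)
  calc ∑ s ∈ S, ‖∑ k ∈ I, u k * b (k + s)‖ ^ 2
      ≤ ‖ContinuousMap.toLp (E := ℂ) 2 ν ℂ (p * q)‖ ^ 2 := by
        refine le_trans (le_of_eq ?_) (ho.sum_inner_products_le (s := S) _)
        exact Finset.sum_congr rfl fun s hs => by rw [hinner s hs]
    _ ≤ (M * ‖ContinuousMap.toLp (E := ℂ) 2 ν ℂ q‖) ^ 2 := by gcongr
    _ = M ^ 2 * ∑ a ∈ A, ‖b a‖ ^ 2 := by rw [mul_pow, hqn]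

/-- Correlation with the coefficients of a trigonometric polynomial bounded by `M` has operator
norm at most `M` on `ℓ²(ℤ^d)`. -/
theorem sum_norm_sq_correlation_le {d : ℕ} {A S I : Finset (Fin d → ℤ)}
    (b u : (Fin d → ℤ) → ℂ) {M : ℝ}
    (hM : ∀ x, ‖∑ k ∈ I, u k * UnitAddTorus.mFourier (-k) x‖ ≤ M)
    (hA : ∀ s ∈ S, ∀ k ∈ I, k + s ∈ A) :
    ∑ s ∈ S, ‖∑ k ∈ I, u k * b (k + s)‖ ^ 2 ≤ M ^ 2 * ∑ a ∈ A, ‖b a‖ ^ 2 :=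
  sum_norm_sq_correlation_le_of_orthonormal
    (ν := Measure.pi fun _ => (AddCircle.haarAddCircle : Measure UnitAddCircle))
    UnitAddTorus.orthonormal_mFourier b u hM hA

/-- Fourier coefficients of a trigonometric polynomial are bounded by its supremum norm. -/
theorem norm_coeff_le {d : ℕ} {I : Finset (Fin d → ℤ)} (u : (Fin d → ℤ) → ℂ) {M : ℝ}
    (hM : ∀ x, ‖∑ k ∈ I, u k * UnitAddTorus.mFourier (-k) x‖ ≤ M) {k : Fin d → ℤ} (hk : k ∈ I) :
    ‖u k‖ ≤ M := by
  have hM0 : 0 ≤ M := (norm_nonneg _).trans (hM 0)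
  -- Correlating with the indicator of `k` at the single shift `0` isolates `u k`.
  have h := sum_norm_sq_correlation_le (A := I) (S := {0}) (Pi.single k 1) u hM
    (by simp)
  have h1 : ∑ j ∈ I, u j * (Pi.single k 1 : (Fin d → ℤ) → ℂ) (j + 0) = u k := by
    simp [Pi.single_apply, hk]
  have h2 : ∑ a ∈ I, ‖(Pi.single k 1 : (Fin d → ℤ) → ℂ) a‖ ^ 2 = 1 := by
    simp [Pi.single_apply, hk, apply_ite]
  rw [Finset.sum_singleton, h1, h2, mul_one] at h
  exact le_of_sq_le_sq h hM0

/-! ### Convex hulls of compact sets -/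

/-- By Carathéodory, `finrank + 1` points suffice, so the hull is a continuous image of a simplex
times a power of `K`. -/
theorem isCompact_convexHull {E : Type*} [NormedAddCommGroup E] [NormedSpace ℝ E]
    [FiniteDimensional ℝ E] {K : Set E} (hK : IsCompact K) : IsCompact (convexHull ℝ K) := by
  rcases K.eq_empty_or_nonempty with rfl | ⟨p₀, hp₀⟩
  · simp
  set n := Module.finrank ℝ E + 1
  have hcomp : IsCompact ((fun q : (Fin n → ℝ) × (Fin n → E) => ∑ i, q.1 i • q.2 i) ''
      (stdSimplex ℝ (Fin n) ×ˢ Set.univ.pi fun _ => K)) :=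
    ((isCompact_stdSimplex ℝ (Fin n)).prod (isCompact_univ_pi fun _ => hK)).image (by fun_prop)
  convert hcomp using 1
  refine Set.Subset.antisymm (fun x hx => ?_) ?_
  · obtain ⟨ι, _, y, w, hy, hind, hw, hw1, rfl⟩ := eq_pos_convex_span_of_mem_convexHull hx
    have hcard : Fintype.card ι ≤ Fintype.card (Fin n) := by
      rw [Fintype.card_fin]
      exact hind.card_le_finrank_succ.trans
        (Nat.succ_le_succ (Submodule.finrank_le _))
    obtain ⟨e⟩ := Function.Embedding.nonempty_of_card_le hcard
    have hzero : ∀ j, j ∉ Set.range e → Function.extend e w 0 j = 0 := fun j hj =>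
      Function.extend_apply' _ _ _ hj
    -- Unused slots receive weight `0` and the dummy point `p₀`.
    refine ⟨(Function.extend e w 0, Function.extend e y fun _ => p₀), ⟨⟨fun j => ?_, ?_⟩, ?_⟩, ?_⟩
    · by_cases hj : j ∈ Set.range e
      · obtain ⟨i, rfl⟩ := hj
        simpa [e.injective.extend_apply] using (hw i).le
      · exact (hzero j hj).ge
    · rw [← hw1]
      refine (Fintype.sum_of_injective e e.injective _ _ (fun j hj => hzero j hj) fun i => ?_).symm
      exact (e.injective.extend_apply _ _ _).symm
    · intro j _
      by_cases hj : j ∈ Set.range e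
      · obtain ⟨i, rfl⟩ := hj
        simpa [e.injective.extend_apply] using hy ⟨i, rfl⟩
      · simpa [Function.extend_apply' _ _ _ hj] using hp₀
    · refine (Fintype.sum_of_injective e e.injective _ _ (fun j hj => ?_) fun i => ?_).symm
      · simp [hzero j hj]
      · simp [e.injective.extend_apply]
  · rintro _ ⟨⟨w, p⟩, ⟨hw, hp⟩, rfl⟩
    exact (convex_convexHull ℝ K).sum_mem (fun i _ => hw.1 i) hw.2
      fun i _ => subset_convexHull ℝ K (hp i trivial)

variable {fc ℓ : ℕ}

/-! ### Duality and atomic representations -/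

/-- `N` bounds the functional `p ↦ ∑ c_k z_k` on the trigonometric polynomials
`p = ∑ c_k e_{-k}` equipped with the supremum norm. -/
def DualBound (z : Idx d fc → ℂ) (N : ℝ) : Prop :=
  ∀ (c : Idx d fc → ℂ) (M : ℝ), 0 < M →
    (∀ x, ‖∑ k, c k * UnitAddTorus.mFourier (-k.1) x‖ ≤ M) → (∑ k, c k * z k).re ≤ N * M

theorem DualBound.nonneg {z : Idx d fc → ℂ} {N : ℝ} (h : DualBound z N) : 0 ≤ N := by
  simpa using h 0 1 one_pos (by simp)

theorem dualBound_tvNorm {z : Idx d fc → ℂ} {μ : ComplexMeasure (UnitAddTorus (Fin d))}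
    (hμ : ∀ k : Idx d fc, measFourierCoeff μ k = z k) : DualBound z (tvNorm μ) := by
  intro c M _ hM
  have h := norm_sum_mul_measFourierCoeff_le μ Finset.univ (fun k : Idx d fc => k.1) c hM
  simp only [hμ] at h
  exact (Complex.re_le_norm _).trans h

theorem dualBound_sum_norm (z : Idx d fc → ℂ) : DualBound z (∑ k, ‖z k‖) := by
  intro c M _ hM
  have hc : ∀ k, ‖c k‖ ≤ M := by
    intro k
    set u : (Fin d → ℤ) → ℂ := fun j => if hj : j ∈ box d fc then c ⟨j, hj⟩ else 0 with hu
    have hcu : ∀ j : Idx d fc, u j.1 = c j := fun j => dif_pos j.2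
    have h := norm_coeff_le (I := box d fc) u (M := M) (fun x => by
      rw [← Finset.sum_coe_sort]
      simpa only [hcu] using hM x) k.2
    rwa [hcu] at h
  refine (Complex.re_le_norm _).trans ((norm_sum_le _ _).trans ?_)
  rw [Finset.sum_mul]
  refine Finset.sum_le_sum fun k _ => ?_
  rw [norm_mul, mul_comm]
  exact mul_le_mul_of_nonneg_left (hc k) (norm_nonneg _)

/-- `z` consists of the low Fourier coefficients of a finite combination of Dirac masses with total
variation at most `N`. -/
def IsAtomic (z : Idx d fc → ℂ) (N : ℝ) : Prop :=
  ∃ (n : ℕ) (a : Fin n → ℝ) (θ : Fin n → Circle) (x : Fin n → UnitAddTorus (Fin d)),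
    (∀ i, 0 ≤ a i) ∧ ∑ i, a i = N ∧
      ∀ k : Idx d fc, z k = ∑ i, (a i : ℂ) * ((θ i : ℂ) * UnitAddTorus.mFourier (-k.1) (x i))

/-- Otherwise a functional with coefficients `c` strictly separates `z` from the compact hull of the
vectors `N θ (e_{-k}(x))_k`. Choosing the phase `θ` optimally turns the bound on the hull into `N
|p(x)| < r` for all `x`, and compactness of the torus leaves a gap that contradicts the dual bound.
-/
theorem DualBound.isAtomic {z : Idx d fc → ℂ} {N : ℝ} (h : DualBound z N) : IsAtomic z N := by
  have hN := h.nonneg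
  set φ : Circle × UnitAddTorus (Fin d) → Idx d fc → ℂ :=
    fun q k => N * (q.1 * UnitAddTorus.mFourier (-k.1) q.2) with hφ
  have hφc : Continuous φ := by
    refine continuous_pi fun k => ?_
    exact continuous_const.mul ((continuous_subtype_val.comp continuous_fst).mul
      ((UnitAddTorus.mFourier (-k.1)).continuous.comp continuous_snd))
  have hK : IsCompact (Set.range φ) := isCompact_range hφc
  have hz : z ∈ convexHull ℝ (Set.range φ) := by
    by_contra hz
    obtain ⟨f, r, hf, hr⟩ := RCLike.geometric_hahn_banach_closed_point (𝕜 := ℂ)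
      (convex_convexHull ℝ (Set.range φ)) (isCompact_convexHull hK).isClosed hz
    set c : Idx d fc → ℂ := fun k => f fun j => if k = j then 1 else 0 with hc
    have hfc : ∀ v, f v = ∑ k, c k * v k := by
      intro v
      refine (LinearMap.pi_apply_eq_sum_univ f.toLinearMap v).trans ?_
      exact Finset.sum_congr rfl fun k _ => mul_comm _ _
    set p : UnitAddTorus (Fin d) → ℝ := fun x => ‖∑ k, c k * UnitAddTorus.mFourier (-k.1) x‖
    have hp : ∀ x, N * p x < r := by
      intro x
      set s := ∑ k, c k * UnitAddTorus.mFourier (-k.1) x with hs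
      obtain ⟨θ, hθ⟩ : ∃ θ : Circle, (θ : ℂ) * s = ‖s‖ := by
        rcases eq_or_ne s 0 with h0 | h0
        · exact ⟨1, by simp [h0]⟩
        · have hn : (‖s‖ : ℂ) ≠ 0 := by simpa using h0
          refine ⟨⟨star s / ‖s‖, mem_sphere_zero_iff_norm.2 ?_⟩, ?_⟩
          · simp [h0]
          · change star s / ‖s‖ * s = ‖s‖
            rw [div_mul_eq_mul_div, div_eq_iff hn, Complex.star_def, Complex.conj_mul', sq]
      have h1 := hf (φ (θ, x)) (subset_convexHull ℝ _ ⟨_, rfl⟩)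
      have h2 : f (φ (θ, x)) = ((N * ‖s‖ : ℝ) : ℂ) := by
        rw [hfc, Complex.ofReal_mul, ← hθ, hs, Finset.mul_sum, Finset.mul_sum]
        exact Finset.sum_congr rfl fun k _ => by simp only [hφ]; ring
      rw [h2] at h1
      simpa using h1
    have hpc : Continuous p := by
      refine continuous_norm.comp (continuous_finsetSum _ fun k _ => ?_)
      exact continuous_const.mul (UnitAddTorus.mFourier (-k.1)).continuous
    obtain ⟨x₀, hx₀⟩ := hpc.exists_forall_ge_of_hasCompactSupport
      (HasCompactSupport.of_compactSpace p)
    -- The shift by `δ` makes the bound `p x₀ + δ` positive even if `p` vanishes, while `N (p x₀ +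
    -- δ) = r - δ < r`. Dividing by `N + 1` also covers `N = 0`.
    set δ := (r - N * p x₀) / (N + 1) with hδ
    have hδ0 : 0 < δ := div_pos (sub_pos.2 (hp x₀)) (by linarith)
    have hδ1 : δ * (N + 1) = r - N * p x₀ := div_mul_cancel₀ _ (by linarith)
    have hp0 : 0 ≤ p x₀ := norm_nonneg _
    have h3 := h c (p x₀ + δ) (by linarith) fun x => (hx₀ x).trans (by linarith)
    rw [← hfc] at h3
    have hr' : r < (f z).re := hr
    nlinarith
  obtain ⟨ι, _, y, w, hy, _, hw, hw1, hwz⟩ := eq_pos_convex_span_of_mem_convexHull hz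
  choose q hq using fun i => hy ⟨i, rfl⟩
  let e := Fintype.equivFin ι
  refine ⟨Fintype.card ι, fun i => w (e.symm i) * N, fun i => (q (e.symm i)).1,
    fun i => (q (e.symm i)).2, fun i => mul_nonneg (hw _).le hN, ?_, fun k => ?_⟩
  · rw [← Finset.sum_mul, e.symm.sum_comp w, hw1, one_mul]
  · rw [← hwz, Finset.sum_apply, ← e.symm.sum_comp]
    refine Finset.sum_congr rfl fun i _ => ?_
    rw [← hq]
    simp [hφ, mul_assoc]

theorem IsAtomic.exists_measure {z : Idx d fc → ℂ} {N : ℝ} (h : IsAtomic z N) :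
    ∃ μ : ComplexMeasure (UnitAddTorus (Fin d)),
      (∀ k : Idx d fc, measFourierCoeff μ k = z k) ∧ tvNorm μ ≤ N := by
  obtain ⟨n, a, θ, x, ha, hN, hz⟩ := h
  obtain ⟨μ, h1, h2⟩ := exists_measure_of_atoms (fun i => (a i : ℂ) * θ i) x
  refine ⟨μ, fun k => ?_, h2.trans ?_⟩
  · rw [h1, hz]
    simp only [mul_assoc]
  · rw [← hN]
    refine Finset.sum_le_sum fun i _ => ?_
    rw [norm_mul, Circle.norm_coe, mul_one, Complex.norm_real, Real.norm_of_nonneg (ha i)]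

/-! ### Semidefinite programs -/

theorem zero_mem_box (d ℓ : ℕ) : (0 : Fin d → ℤ) ∈ box d ℓ :=
  Finset.mem_Icc.2 ⟨fun _ => by simp, fun _ => by simp⟩

theorem box_mono {ℓ' : ℕ} (h : ℓ ≤ ℓ') : box d ℓ ⊆ box d ℓ' := by
  have h' : (ℓ : ℤ) ≤ ℓ' := by exact_mod_cast h
  exact Finset.Icc_subset_Icc (fun _ => neg_le_neg h') (fun _ => h')

theorem add_mem_box (h : fc ≤ ℓ) {k s : Fin d → ℤ} (hk : k ∈ box d fc)
    (hs : s ∈ box d (ℓ - fc)) : k + s ∈ box d ℓ := by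
  rw [Finset.mem_Icc] at *
  have e : ((ℓ - fc : ℕ) : ℤ) = ℓ - fc := by push_cast [h]; ring
  refine ⟨fun i => ?_, fun i => ?_⟩
  · have := hk.1 i; have := hs.1 i; simp only [Pi.add_apply] at *; omega
  · have := hk.2 i; have := hs.2 i; simp only [Pi.add_apply] at *; omega

theorem IsToeplitz.trace_eq {R : Matrix (Idx d ℓ) (Idx d ℓ) ℂ} (hR : IsToeplitz R) :
    R.trace = (2 * (ℓ : ℂ) + 1) ^ d * R ⟨0, zero_mem_box d ℓ⟩ ⟨0, zero_mem_box d ℓ⟩ := by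
  have h : ∀ i, R i i = R ⟨0, zero_mem_box d ℓ⟩ ⟨0, zero_mem_box d ℓ⟩ := by
    intro i
    have := hR ⟨0, zero_mem_box d ℓ⟩ ⟨0, zero_mem_box d ℓ⟩ i
      (by simp) (by simp)
    simpa using this
  simp only [Matrix.trace, Matrix.diag_apply, h, Finset.sum_const, Finset.card_univ, card_idx,
    nsmul_eq_mul]
  push_cast
  rfl

/-- This makes objectives of different orders comparable: the normalized trace is one entry, which
restriction to a smaller box preserves. -/
theorem IsToeplitz.normalized_trace_re {R : Matrix (Idx d ℓ) (Idx d ℓ) ℂ} (hR : IsToeplitz R) :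
    1 / (2 * (ℓ : ℝ) + 1) ^ d * R.trace.re =
      (R ⟨0, zero_mem_box d ℓ⟩ ⟨0, zero_mem_box d ℓ⟩).re := by
  have h : (2 * (ℓ : ℂ) + 1) ^ d = (((2 * (ℓ : ℝ) + 1) ^ d : ℝ) : ℂ) := by push_cast; rfl
  rw [hR.trace_eq, h, Complex.re_ofReal_mul]
  field_simp

/-- The block matrix is `∑ a_i v_i v_i^*` with `v_i = ((e_{-k}(x_i))_k, conj θ_i)`, hence positive
semidefinite. The entries of `R` depend only on `k - j`, and its diagonal and `τ` both equal `∑ a_i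
= N`. -/
theorem IsAtomic.mem_sdpValues {z : Idx d fc → ℂ} {N : ℝ} (h : IsAtomic z N) (ℓ : ℕ) :
    N ∈ sdpValues z ℓ := by
  obtain ⟨n, a, θ, x, ha, hN, hz⟩ := h
  set v : Fin n → Idx d ℓ ⊕ Unit → ℂ := fun i =>
    Sum.elim (fun k => UnitAddTorus.mFourier (-k.1) (x i)) (fun _ => star (θ i : ℂ)) with hv
  set R : Matrix (Idx d ℓ) (Idx d ℓ) ℂ := Matrix.of fun j k => ∑ i, (a i : ℂ) *
    UnitAddTorus.mFourier (k.1 - j.1) (x i) with hR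
  set w : Idx d ℓ → ℂ := fun k =>
    ∑ i, (a i : ℂ) * ((θ i : ℂ) * UnitAddTorus.mFourier (-k.1) (x i)) with hw
  have hblock : blockMatrix R w N = ∑ i, (a i : ℂ) • Matrix.vecMulVec (v i) (star (v i)) := by
    have hθ : ∀ i, star (θ i : ℂ) * θ i = 1 := by
      intro i
      rw [Complex.star_def, Complex.conj_mul', Circle.norm_coe]
      simp
    ext (j | j) (k | k)
    · simp [blockMatrix, Matrix.sum_apply, Matrix.vecMulVec_apply, hv, hR,
        ← UnitAddTorus.mFourier_neg, ← UnitAddTorus.mFourier_add, sub_eq_add_neg, add_comm]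
    · simp [blockMatrix, Matrix.sum_apply, Matrix.vecMulVec_apply, hv, hw, mul_comm]
    · simp [blockMatrix, Matrix.sum_apply, Matrix.vecMulVec_apply, hv, hw]
    · simp only [blockMatrix, Matrix.fromBlocks_apply₂₂, Matrix.of_apply, Matrix.sum_apply,
        Matrix.smul_apply, Matrix.vecMulVec_apply, hv, Sum.elim_inr, Pi.star_apply, star_star, hθ,
        smul_eq_mul, mul_one, ← hN]
      push_cast
      rfl
  have hpsd : (blockMatrix R w N).PosSemidef := by
    rw [hblock]
    refine Matrix.posSemidef_sum _ fun i _ => ?_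
    refine (Matrix.posSemidef_vecMulVec_self_star (v i)).smul ?_
    exact_mod_cast ha i
  have htoep : IsToeplitz R := by
    intro i j k hi hj
    simp [hR]
  refine ⟨R, w, N, ⟨?_, hpsd, ?_, htoep⟩, ?_⟩
  · exact hpsd.submatrix Sum.inl
  · intro k hc hℓ
    rw [hz]
  · rw [htoep.normalized_trace_re]
    have : R ⟨0, zero_mem_box d ℓ⟩ ⟨0, zero_mem_box d ℓ⟩ = N := by
      simp [hR, UnitAddTorus.mFourier_zero, ← hN]
    rw [this, Complex.ofReal_re]
    ring

/-- The inclusion of index sets. -/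
def idxIncl {ℓ' : ℕ} (h : ℓ ≤ ℓ') (k : Idx d ℓ) : Idx d ℓ' := ⟨k.1, box_mono h k.2⟩

/-- Fejér-type bound for the quadratic form of a positive semidefinite Toeplitz matrix. -/
theorem IsToeplitz.quadForm_le {R : Matrix (Idx d ℓ) (Idx d ℓ) ℂ} (hT : IsToeplitz R)
    (hR : R.PosSemidef) (h : fc ≤ ℓ) (c : Idx d fc → ℂ) {M : ℝ}
    (hM : ∀ x, ‖∑ k, c k * UnitAddTorus.mFourier (-k.1) x‖ ≤ M) :
    (2 * ((ℓ - fc : ℕ) : ℝ) + 1) ^ d *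
      (∑ j, ∑ k, c j * R (idxIncl h j) (idxIncl h k) * star (c k)).re ≤ M ^ 2 * R.trace.re := by
  obtain ⟨n, v, hv⟩ := Matrix.posSemidef_iff_eq_sum_vecMulVec.1 hR
  have hentry : ∀ a b, R a b = ∑ i, v i a * star (v i b) := by
    intro a b
    rw [hv]
    simp [Matrix.sum_apply, Matrix.vecMulVec_apply]
  set u : (Fin d → ℤ) → ℂ := fun j => if hj : j ∈ box d fc then c ⟨j, hj⟩ else 0 with hu
  have hcu : ∀ j : Idx d fc, u j.1 = c j := fun j => dif_pos j.2
  set b : Fin n → (Fin d → ℤ) → ℂ := fun i a => if ha : a ∈ box d ℓ then v i ⟨a, ha⟩ else 0 with hb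
  have hbv : ∀ i (a : Fin d → ℤ) (ha : a ∈ box d ℓ), b i a = v i ⟨a, ha⟩ := fun i a ha => dif_pos ha
  -- The Toeplitz property lets the small box be translated by any such `s` without changing the
  -- quadratic form; decomposing `R` into rank-one terms then gives correlation sums, to be summed
  -- over all shifts.
  have hquad : ∀ s ∈ box d (ℓ - fc),
      (∑ j, ∑ k, c j * R (idxIncl h j) (idxIncl h k) * star (c k)).re =
        ∑ i, ‖∑ k ∈ box d fc, u k * b i (k + s)‖ ^ 2 := by
    intro s hs
    have hsq : ∀ i, ((‖∑ k ∈ box d fc, u k * b i (k + s)‖ ^ 2 : ℝ) : ℂ) =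
        ∑ j : Idx d fc, ∑ k : Idx d fc,
          c j * (b i (j.1 + s) * star (b i (k.1 + s))) * star (c k) := by
      intro i
      rw [Complex.ofReal_pow, ← Complex.mul_conj', ← Finset.sum_coe_sort (box d fc), map_sum,
        Finset.sum_mul_sum]
      refine Finset.sum_congr rfl fun j _ => Finset.sum_congr rfl fun k _ => ?_
      rw [hcu, hcu, map_mul, Complex.star_def]
      ring
    rw [← Complex.ofReal_re (∑ i, _), Complex.ofReal_sum]
    congr 1
    simp only [hsq]
    refine Eq.trans (Finset.sum_congr rfl fun j _ => Eq.trans (Finset.sum_congr rfl fun k _ => ?_)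
      Finset.sum_comm) Finset.sum_comm
    have ht := hT (idxIncl h j) (idxIncl h k) ⟨s, box_mono (Nat.sub_le _ _) hs⟩
      (add_mem_box h j.2 hs) (add_mem_box h k.2 hs)
    rw [← ht, hentry, Finset.mul_sum, Finset.sum_mul]
    refine Finset.sum_congr rfl fun i _ => ?_
    rw [hbv i _ (add_mem_box h j.2 hs), hbv i _ (add_mem_box h k.2 hs)]
    rfl
  have htrace : R.trace.re = ∑ i, ∑ a ∈ box d ℓ, ‖b i a‖ ^ 2 := by
    rw [← Complex.ofReal_re (∑ i, _)]
    congr 1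
    push_cast
    rw [Finset.sum_comm, ← Finset.sum_coe_sort (box d ℓ), Matrix.trace]
    refine Finset.sum_congr rfl fun a _ => ?_
    rw [Matrix.diag_apply, hentry]
    refine Finset.sum_congr rfl fun i _ => ?_
    rw [hbv i a.1 a.2, ← Complex.mul_conj']
    rfl
  have hcard : ((box d (ℓ - fc)).card : ℝ) = (2 * ((ℓ - fc : ℕ) : ℝ) + 1) ^ d := by
    have := card_idx d (ℓ - fc)
    rw [Fintype.card_coe] at this
    rw [this]
    push_cast
    rfl
  rw [← hcard, ← nsmul_eq_mul, ← Finset.sum_const, Finset.sum_congr rfl hquad, Finset.sum_comm,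
    htrace, Finset.mul_sum]
  refine Finset.sum_le_sum fun i _ => sum_norm_sq_correlation_le _ _ (fun x => ?_) fun s hs k hk =>
    add_mem_box h hk hs
  rw [← Finset.sum_coe_sort (box d fc)]
  simpa only [hcu] using hM x

/-- The block form, restricted to the small box, is tested on the vector `(conj c, -M)`. -/
theorem re_sum_mul_le_of_block_posSemidef {R : Matrix (Idx d ℓ) (Idx d ℓ) ℂ} {w : Idx d ℓ → ℂ}
    {τ : ℝ} (hB : (blockMatrix R w τ).PosSemidef) (h : fc ≤ ℓ) (c : Idx d fc → ℂ) (M : ℝ) :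
    2 * M * (∑ k, c k * w (idxIncl h k)).re ≤
      (∑ j, ∑ k, c j * R (idxIncl h j) (idxIncl h k) * star (c k)).re + τ * M ^ 2 := by
  have h0 := (hB.submatrix (Sum.map (idxIncl h) id)).dotProduct_mulVec_nonneg
    (Sum.elim (fun k => star (c k)) fun _ => -(M : ℂ))
  have h1 := (Complex.le_def.1 h0).1
  set Q := ∑ j, ∑ k, c j * R (idxIncl h j) (idxIncl h k) * star (c k) with hQ
  set S := ∑ k, c k * w (idxIncl h k) with hS
  have hexp : star (Sum.elim (fun k => star (c k)) fun _ => -(M : ℂ)) ⬝ᵥ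
      ((blockMatrix R w τ).submatrix (Sum.map (idxIncl h) id) (Sum.map (idxIncl h) id)).mulVec
        (Sum.elim (fun k => star (c k)) fun _ => -(M : ℂ)) =
      Q - M * S - M * star S + τ * M ^ 2 := by
    simp only [dotProduct, Matrix.mulVec, Fintype.sum_sum_type, blockMatrix, Finset.univ_unique,
      Finset.sum_singleton, hQ, hS]
    simp [Finset.mul_sum, mul_add, Finset.sum_add_distrib]
    simp only [mul_assoc, mul_left_comm, mul_comm, sq, sub_eq_add_neg, add_assoc]
  rw [hexp] at h1
  simp [← Complex.ofReal_pow] at h1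
  linarith

/-- Every feasible point of the semidefinite relaxation yields a dual bound. -/
theorem SdpFeasible.dualBound {z : Idx d fc → ℂ} {R : Matrix (Idx d ℓ) (Idx d ℓ) ℂ}
    {w : Idx d ℓ → ℂ} {τ : ℝ} (hf : SdpFeasible z ℓ R w τ) (h : fc ≤ ℓ) :
    DualBound z (1 / 2 * (1 / (2 * ((ℓ - fc : ℕ) : ℝ) + 1) ^ d * R.trace.re + τ)) := by
  intro c M hM0 hM
  have h1 := hf.toeplitz.quadForm_le hf.posSemidef h c hM
  have h2 := re_sum_mul_le_of_block_posSemidef hf.block_posSemidef h c M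
  have hw : ∀ k : Idx d fc, w (idxIncl h k) = z k := fun k => hf.interp k.1 k.2 _
  simp only [hw] at h2
  set Q := (∑ j, ∑ k, c j * R (idxIncl h j) (idxIncl h k) * star (c k)).re
  set m : ℝ := (2 * ((ℓ - fc : ℕ) : ℝ) + 1) ^ d
  have hm : 0 < m := by positivity
  have hQ : Q ≤ M ^ 2 * (1 / m * R.trace.re) := by
    rw [one_div, mul_left_comm, ← div_eq_inv_mul, le_div_iff₀ hm]
    linarith
  -- Both terms on the right are quadratic in `M`, so one factor `M > 0` cancels.
  have h3 : M * (∑ k, c k * z k).re ≤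
      M * (1 / 2 * (1 / m * R.trace.re + τ) * M) := by nlinarith
  exact le_of_mul_le_mul_left h3 hM0

/-! ### Attainment for the semidefinite programs -/

/-- In a rank-one decomposition, `|v_i v_j| ≤ (|v_i|² + |v_j|²) / 2`. This bounds the sublevel sets
of the semidefinite program. -/
theorem norm_apply_le_of_posSemidef {n : Type*} [Fintype n] {A : Matrix n n ℂ}
    (hA : A.PosSemidef) (i j : n) : ‖A i j‖ ≤ A.trace.re := by
  obtain ⟨m, v, hv⟩ := Matrix.posSemidef_iff_eq_sum_vecMulVec.1 hA
  have hentry : ∀ a b, A a b = ∑ l, v l a * star (v l b) := by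
    intro a b
    rw [hv]
    simp [Matrix.sum_apply, Matrix.vecMulVec_apply]
  have htrace : A.trace.re = ∑ l, ∑ a, ‖v l a‖ ^ 2 := by
    rw [← Complex.ofReal_re (∑ i, _)]
    congr 1
    push_cast
    rw [Finset.sum_comm, Matrix.trace]
    refine Finset.sum_congr rfl fun a _ => ?_
    rw [Matrix.diag_apply, hentry]
    exact Finset.sum_congr rfl fun l _ => Complex.mul_conj' _
  rw [hentry, htrace]
  refine (norm_sum_le _ _).trans (Finset.sum_le_sum fun l _ => ?_)
  have h1 : ‖v l i‖ ^ 2 ≤ ∑ a, ‖v l a‖ ^ 2 :=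
    Finset.single_le_sum (f := fun a => ‖v l a‖ ^ 2) (fun _ _ => by positivity) (Finset.mem_univ i)
  have h2 : ‖v l j‖ ^ 2 ≤ ∑ a, ‖v l a‖ ^ 2 :=
    Finset.single_le_sum (f := fun a => ‖v l a‖ ^ 2) (fun _ _ => by positivity) (Finset.mem_univ j)
  rw [norm_mul, norm_star]
  nlinarith [sq_nonneg (‖v l i‖ - ‖v l j‖)]

theorem isClosed_posSemidef {X n : Type*} [TopologicalSpace X] [Fintype n]
    {A : X → Matrix n n ℂ} (hA : Continuous A) : IsClosed {x | (A x).PosSemidef} := by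
  simp only [Matrix.posSemidef_iff_dotProduct_mulVec, Set.ofPred_and, Set.ofPred_forall]
  refine IsClosed.inter (isClosed_eq hA.matrix_conjTranspose hA) (isClosed_iInter fun y => ?_)
  exact isClosed_le continuous_const
    (continuous_const.dotProduct (hA.matrix_mulVec continuous_const))

theorem trace_blockMatrix (R : Matrix (Idx d ℓ) (Idx d ℓ) ℂ) (w : Idx d ℓ → ℂ) (τ : ℝ) :
    (blockMatrix R w τ).trace.re = R.trace.re + τ := by
  simp [blockMatrix, Matrix.trace, Fintype.sum_sum_type]

theorem SdpFeasible.trace_nonneg {z : Idx d fc → ℂ} {R : Matrix (Idx d ℓ) (Idx d ℓ) ℂ}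
    {w : Idx d ℓ → ℂ} {τ : ℝ} (hf : SdpFeasible z ℓ R w τ) : 0 ≤ R.trace.re :=
  (Complex.le_def.1 hf.posSemidef.trace_nonneg).1

theorem SdpFeasible.tau_nonneg {z : Idx d fc → ℂ} {R : Matrix (Idx d ℓ) (Idx d ℓ) ℂ}
    {w : Idx d ℓ → ℂ} {τ : ℝ} (hf : SdpFeasible z ℓ R w τ) : 0 ≤ τ := by
  have h := (Complex.le_def.1 (hf.block_posSemidef.diag_nonneg (i := Sum.inr ()))).1
  simpa [blockMatrix] using h

theorem isClosed_sdpFeasible (z : Idx d fc → ℂ) (ℓ : ℕ) :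
    IsClosed {q : Matrix (Idx d ℓ) (Idx d ℓ) ℂ × (Idx d ℓ → ℂ) × ℝ |
      SdpFeasible z ℓ q.1 q.2.1 q.2.2} := by
  have hset : {q : Matrix (Idx d ℓ) (Idx d ℓ) ℂ × (Idx d ℓ → ℂ) × ℝ |
      SdpFeasible z ℓ q.1 q.2.1 q.2.2} =
      {q | q.1.PosSemidef} ∩ ({q | (blockMatrix q.1 q.2.1 q.2.2).PosSemidef} ∩
        ({q | ∀ (k : Fin d → ℤ) (hc : k ∈ box d fc) (hℓ : k ∈ box d ℓ),
          q.2.1 ⟨k, hℓ⟩ = z ⟨k, hc⟩} ∩ {q | IsToeplitz q.1})) := by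
    ext q
    exact ⟨fun h => ⟨h.1, h.2, h.3, h.4⟩, fun h => ⟨h.1, h.2.1, h.2.2.1, h.2.2.2⟩⟩
  rw [hset]
  refine (isClosed_posSemidef continuous_fst).inter (IsClosed.inter (isClosed_posSemidef ?_)
    (IsClosed.inter ?_ ?_))
  · refine Continuous.matrix_fromBlocks continuous_fst ?_ ?_ ?_
    · exact continuous_matrix fun i _ =>
        (continuous_apply i).comp (continuous_fst.comp continuous_snd)
    · exact continuous_matrix fun _ j => continuous_star.comp
        ((continuous_apply j).comp (continuous_fst.comp continuous_snd))
    · exact continuous_matrix fun _ _ => Complex.continuous_ofReal.comp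
        (continuous_snd.comp continuous_snd)
  · simp only [Set.ofPred_forall]
    refine isClosed_iInter fun k => isClosed_iInter fun hc => isClosed_iInter fun hℓ => ?_
    exact isClosed_eq ((continuous_apply _).comp (continuous_fst.comp continuous_snd))
      continuous_const
  · simp only [IsToeplitz, Set.ofPred_forall]
    refine isClosed_iInter fun i => isClosed_iInter fun j => isClosed_iInter fun k =>
      isClosed_iInter fun hi => isClosed_iInter fun hj => ?_
    exact isClosed_eq (continuous_fst.matrix_elem _ _) (continuous_fst.matrix_elem _ _)

theorem isLeast_sdpMin {z : Idx d fc → ℂ} (hne : (sdpValues z ℓ).Nonempty) :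
    IsLeast (sdpValues z ℓ) (sdpMin z ℓ) := by
  obtain ⟨v₀, R₀, w₀, τ₀, hf₀, hv₀⟩ := hne
  set m : ℝ := (2 * (ℓ : ℝ) + 1) ^ d with hm
  have hm0 : 0 < m := by positivity
  set obj : Matrix (Idx d ℓ) (Idx d ℓ) ℂ × (Idx d ℓ → ℂ) × ℝ → ℝ :=
    fun q => 1 / 2 * (1 / m * q.1.trace.re + q.2.2) with hobj
  have hobjc : Continuous obj := by
    have h1 : Continuous fun q : Matrix (Idx d ℓ) (Idx d ℓ) ℂ × (Idx d ℓ → ℂ) × ℝ =>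
        q.1.trace.re := Complex.continuous_re.comp continuous_fst.matrix_trace
    fun_prop
  set F := {q : Matrix (Idx d ℓ) (Idx d ℓ) ℂ × (Idx d ℓ → ℂ) × ℝ |
      SdpFeasible z ℓ q.1 q.2.1 q.2.2} ∩ {q | obj q ≤ v₀} with hF
  -- Since `tr R` and `τ` are nonnegative, objective at most `v₀` forces `tr R ≤ 2 m v₀` and `τ ≤ 2
  -- v₀`; `C` bounds the trace of the block matrix.
  set C : ℝ := 2 * m * v₀ + 2 * v₀ with hC
  have hFc : IsCompact F := by
    have hball : IsCompact (Metric.closedBall (0 : ℂ) C) := isCompact_closedBall _ _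
    have hbig : IsCompact ((Set.univ.pi fun _ : Idx d ℓ => Set.univ.pi fun _ : Idx d ℓ =>
        Metric.closedBall (0 : ℂ) C) ×ˢ ((Set.univ.pi fun _ : Idx d ℓ =>
        Metric.closedBall (0 : ℂ) C) ×ˢ Set.Icc (0 : ℝ) (2 * v₀))) :=
      (isCompact_univ_pi fun _ => isCompact_univ_pi fun _ => hball).prod
        ((isCompact_univ_pi fun _ => hball).prod isCompact_Icc)
    refine IsCompact.of_isClosed_subset hbig ((isClosed_sdpFeasible z ℓ).inter
      (isClosed_le hobjc continuous_const)) ?_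
    rintro ⟨R, w, τ⟩ ⟨hf, hv⟩
    have hf' : SdpFeasible z ℓ R w τ := hf
    have hv' : 1 / 2 * (1 / m * R.trace.re + τ) ≤ v₀ := hv
    have ht := hf'.trace_nonneg
    have hτ := hf'.tau_nonneg
    have ht' : 0 ≤ 1 / m * R.trace.re := by positivity
    have hR : R.trace.re ≤ 2 * m * v₀ := by
      have : R.trace.re = m * (1 / m * R.trace.re) := by field_simp
      rw [this]
      nlinarith
    have hτ' : τ ≤ 2 * v₀ := by linarith
    have hle : (blockMatrix R w τ).trace.re ≤ C := by
      rw [trace_blockMatrix]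
      linarith
    have hB := fun i j => (norm_apply_le_of_posSemidef hf'.block_posSemidef i j).trans hle
    refine ⟨fun i _ j _ => ?_, fun i _ => ?_, hτ, hτ'⟩
    · exact mem_closedBall_zero_iff.2 (hB (Sum.inl i) (Sum.inl j))
    · exact mem_closedBall_zero_iff.2 (hB (Sum.inl i) (Sum.inr ()))
  obtain ⟨q, hq, hmin⟩ := hFc.exists_isMinOn ⟨(R₀, w₀, τ₀), hf₀, hv₀.ge⟩ hobjc.continuousOn
  have hleast : IsLeast (sdpValues z ℓ) (obj q) := by
    refine ⟨⟨q.1, q.2.1, q.2.2, hq.1, rfl⟩, ?_⟩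
    rintro v ⟨R, w, τ, hf, rfl⟩
    rcases le_total (obj (R, w, τ)) v₀ with hle | hle
    · exact hmin (⟨hf, hle⟩ : (R, w, τ) ∈ F)
    · exact le_trans hq.2 hle
  rw [sdpMin, hleast.csInf_eq]
  exact hleast

theorem sdpValues_subset_of_le {z : Idx d fc → ℂ} {ℓ' : ℕ} (h : ℓ ≤ ℓ') :
    sdpValues z ℓ' ⊆ sdpValues z ℓ := by
  rintro v ⟨R, w, τ, hf, rfl⟩
  have hT : IsToeplitz (R.submatrix (idxIncl h) (idxIncl h)) := fun i j k _ _ =>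
    hf.toeplitz (idxIncl h i) (idxIncl h j) (idxIncl h k) _ _
  refine ⟨R.submatrix (idxIncl h) (idxIncl h), fun k => w (idxIncl h k), τ,
    ⟨hf.posSemidef.submatrix _, ?_, fun k hc hℓ => hf.interp k hc _, hT⟩, ?_⟩
  · convert hf.block_posSemidef.submatrix (Sum.map (idxIncl h) id) using 1
    ext (i | i) (j | j) <;> rfl
  · rw [hT.normalized_trace_re, hf.toeplitz.normalized_trace_re]
    rfl

end SuperRes

theorem mainTheorem2 (d fc : ℕ) (z : SuperRes.Idx d fc → ℂ) :
    -- the infima are minima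
    IsLeast (SuperRes.tvValues z) (SuperRes.tvMin z) ∧
    (∀ ℓ : ℕ, fc ≤ ℓ → IsLeast (SuperRes.sdpValues z ℓ) (SuperRes.sdpMin z ℓ)) ∧
    -- the hierarchy of lower bounds
    (∀ ℓ : ℕ, fc ≤ ℓ →
      SuperRes.sdpMin z ℓ ≤ SuperRes.sdpMin z (ℓ + 1) ∧
      SuperRes.sdpMin z (ℓ + 1) ≤ SuperRes.tvMin z) ∧
    -- convergence
    Tendsto (fun ℓ : ℕ => SuperRes.sdpMin z ℓ) atTop (𝓝 (SuperRes.tvMin z)) := by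
  open SuperRes in
  have hbdd : BddBelow (tvValues z) := by
    refine ⟨0, ?_⟩
    rintro _ ⟨μ, _, rfl⟩
    exact measureReal_nonneg
  have hle_of_atomic : ∀ {N : ℝ}, IsAtomic z N → tvMin z ≤ N := by
    intro N hN
    obtain ⟨μ, hμ, hμN⟩ := hN.exists_measure
    exact (csInf_le hbdd ⟨μ, hμ, rfl⟩).trans hμN
  have hne : (tvValues z).Nonempty := by
    obtain ⟨μ, hμ, _⟩ := (dualBound_sum_norm z).isAtomic.exists_measure
    exact ⟨_, μ, hμ, rfl⟩
  -- Dual bounds are stable under infima, so the atomic representation applies at the infimum itself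
  -- and yields a minimizer.
  have hdual : DualBound z (tvMin z) := by
    intro c M hM0 hM
    rw [← div_le_iff₀ hM0]
    refine le_csInf hne ?_
    rintro _ ⟨μ, hμ, rfl⟩
    rw [div_le_iff₀ hM0]
    exact dualBound_tvNorm hμ c M hM0 hM
  have hatomic := hdual.isAtomic
  have htv : IsLeast (tvValues z) (tvMin z) := by
    refine ⟨?_, fun v hv => csInf_le hbdd hv⟩
    obtain ⟨μ, hμ, hμN⟩ := hatomic.exists_measure
    exact ⟨μ, hμ, le_antisymm (csInf_le hbdd ⟨μ, hμ, rfl⟩) hμN⟩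
  have hsdp : ∀ ℓ, IsLeast (sdpValues z ℓ) (sdpMin z ℓ) := fun ℓ =>
    isLeast_sdpMin ⟨_, hatomic.mem_sdpValues ℓ⟩
  have hupper : ∀ ℓ, sdpMin z ℓ ≤ tvMin z := fun ℓ => (hsdp ℓ).2 (hatomic.mem_sdpValues ℓ)
  refine ⟨htv, fun ℓ _ => hsdp ℓ, fun ℓ _ => ⟨?_, hupper _⟩, ?_⟩
  · exact (hsdp ℓ).2 (sdpValues_subset_of_le (Nat.le_succ ℓ) (hsdp (ℓ + 1)).1)
  · set ρ : ℕ → ℝ := fun ℓ => ((2 * ((ℓ - fc : ℕ) : ℝ) + 1) / (2 * (ℓ : ℝ) + 1)) ^ d with hρ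
    have hlower : ∀ ℓ, fc ≤ ℓ → ρ ℓ * tvMin z ≤ sdpMin z ℓ := by
      intro ℓ hℓ
      obtain ⟨R, w, τ, hf, hv⟩ := (hsdp ℓ).1
      have h1 := hle_of_atomic (hf.dualBound hℓ).isAtomic
      have hτ := hf.tau_nonneg
      have hle : ((ℓ - fc : ℕ) : ℝ) ≤ ℓ := by exact_mod_cast Nat.sub_le _ _
      have hρ0 : 0 ≤ ρ ℓ := by positivity
      have hρ1 : ρ ℓ ≤ 1 :=
        pow_le_one₀ (by positivity) ((div_le_one (by positivity)).2 (by linarith))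
      have heq : ρ ℓ * (1 / (2 * ((ℓ - fc : ℕ) : ℝ) + 1) ^ d * R.trace.re) =
          1 / (2 * (ℓ : ℝ) + 1) ^ d * R.trace.re := by
        simp only [hρ, div_pow]
        field_simp
      -- Multiplying by `ρ ℓ` restores the normalization of the trace; the remaining term satisfies
      -- `ρ ℓ * τ ≤ τ`.
      have h2 := mul_le_mul_of_nonneg_left h1 hρ0
      rw [hv]
      nlinarith
    have hρlim : Tendsto ρ atTop (𝓝 1) := by
      have hden : Tendsto (fun ℓ : ℕ => 2 * (ℓ : ℝ) + 1) atTop atTop :=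
        tendsto_atTop_add_const_right _ _
          (tendsto_natCast_atTop_atTop.const_mul_atTop (by norm_num))
      -- For `ℓ ≥ fc` the subtraction is not truncated and `ρ ℓ = (1 - 2 fc / (2ℓ+1))^d`.
      have hlim := ((hden.const_div_atTop (2 * (fc : ℝ))).const_sub 1).pow d
      rw [sub_zero, one_pow] at hlim
      refine hlim.congr' ?_
      filter_upwards [eventually_ge_atTop fc] with ℓ hℓ
      simp only [hρ, Nat.cast_sub hℓ]
      congr 1
      have : (2 * (ℓ : ℝ) + 1) ≠ 0 := by positivity
      field_simp
      ring
    refine tendsto_of_tendsto_of_tendsto_of_le_of_le' (g := fun ℓ => ρ ℓ * tvMin z)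
      (h := fun _ => tvMin z) ?_ tendsto_const_nhds ?_ (Eventually.of_forall hupper)
    · simpa using hρlim.mul_const (tvMin z)
    · filter_upwards [eventually_ge_atTop fc] with ℓ hℓ using hlower ℓ hℓ

end
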